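/- Let $H$ be a finite dimensional semisimple Hopf algebra, with comultiplication $\Delta$, counit $\varepsilon$ and antipode $S$, over an algebraically closed field $k$ of positive characteristic $p$ with $p>(\dim_k H)^{1/2}$ and $p\nmid 2\dim_k H$. Let $V_0,\dots,V_{m-1}$ be a complete list of pairwise non-isomorphic simple $H$-modules, $V_0$ being the trivial module, with characters $\chi_i$ and dimensions $d_i$, and let $e_i\in H$ be the central primitive idempotent that acts as the identity on $V_i$ and annihilates $V_j$ for $j\ne i$. Let $\Lambda\in H$ be a left integral and $\lambda\in H^*$ a right integral with $\lambda(\Lambda)=1$, put $u=S(\Lambda_{(2)})\Lambda_{(1)}$, and, for square roots $s=\sqrt{\varepsilon(\Lambda)}$ and $r_i=\sqrt{\lambda(e_i)}$ in $k$, $$v=\frac{u}{s}\sum_{i=0}^{m-1}\frac{r_i}{d_i}\,e_i .$$ Let $G_0(H)$ be the Grothendieck group of finite dimensional $H$-modules. The $k$-linear map $G_0(H)\otimes_{\mathbb Z}k\to H^*$ that sends the class of a module to its character is injective, and it sends $[V_0]$ to $\varepsilon$; regard $G_0(H)\otimes_{\mathbb Z}k$ as a subspace of $H^*$ through it. Then: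 (a) The roots can be chosen such that $s r_0=1$ and such that, in case $S^2=\mathrm{id}$, $s r_i=d_i$ for all $i$. (b) For every choice of the roots, $v$ is invertible, and the bilinear operation $$(\chi\star\psi)(h)=(\chi\otimes\psi)\bigl(\Delta(h)\Delta(v^{-1})(v\otimes v)\bigr),\qquad h\in H,$$ maps $G_0(H)\otimes_{\mathbb Z}k$ into itself and is associative there. If $s r_0=1$, then $\varepsilon$ is a two-sided unit for $\star$, so that $(G_0(H)\otimes_{\mathbb Z}k,\star)$ is an associative $k$-algebra with unit $\varepsilon$. (c) If $S^2=\mathrm{id}$ and the roots satisfy $s r_i=d_i$ for all $i$, then $\star$ is the convolution $(\chi*\psi)(h)=(\chi\otimes\psi)(\Delta(h))$ on $G_0(H)\otimes_{\mathbb Z}k$. -/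

import Mathlib

open scoped TensorProduct

universe w u

noncomputable section

namespace HopfStar

/-- The trace of an endomorphism of a short exact sequence of finite dimensional vector spaces
is additive. -/
theorem trace_of_exact {k : Type*} [Field k] {L M N : Type*}
    [AddCommGroup L] [Module k L] [Module.Finite k L]
    [AddCommGroup M] [Module k M] [Module.Finite k M]
    [AddCommGroup N] [Module k N] [Module.Finite k N]
    (f : L →ₗ[k] M) (g : M →ₗ[k] N) (hf : Function.Injective f) (hg : Function.Surjective g)
    (hfg : Function.Exact f g) (a : L →ₗ[k] L) (b : M →ₗ[k] M) (c : N →ₗ[k] N)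
    (hab : b ∘ₗ f = f ∘ₗ a) (hbc : g ∘ₗ b = c ∘ₗ g) :
    LinearMap.trace k M b = LinearMap.trace k L a + LinearMap.trace k N c := by
  obtain ⟨s, hs⟩ := g.exists_rightInverse_of_surjective (LinearMap.range_eq_top.mpr hg)
  obtain ⟨e, rfl, rfl⟩ := ((Function.Exact.split_tfae' hfg).out 0 2 rfl rfl).mp ⟨hf, s, hs⟩
  have hsplit : b = (b ∘ₗ e.symm.toLinearMap ∘ₗ LinearMap.inl k L N) ∘ₗ
        (LinearMap.fst k L N ∘ₗ e.toLinearMap) +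
      (b ∘ₗ e.symm.toLinearMap ∘ₗ LinearMap.inr k L N) ∘ₗ
        (LinearMap.snd k L N ∘ₗ e.toLinearMap) := by
    ext x
    simp [← map_add]
  rw [hsplit, map_add, LinearMap.trace_comp_comm', LinearMap.trace_comp_comm' (M := M) (N := N)]
  congr 2
  · rw [hab]
    ext x
    simp
  · ext x
    have := LinearMap.congr_fun hbc (e.symm (0, x))
    simpa using this

section Modules

variable (k : Type w) [Field k] (H : Type u) [Ring H] [Algebra k H]

/-- Finite dimensional (left) modules over the `k`-algebra `H`, bundled. -/
structure FinModule where
  carrier : Type u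
  [addCommGroup : AddCommGroup carrier]
  [moduleK : Module k carrier]
  [moduleH : Module H carrier]
  [isScalarTower : IsScalarTower k H carrier]
  [finite : Module.Finite k carrier]

attribute [instance] FinModule.addCommGroup FinModule.moduleK FinModule.moduleH
  FinModule.isScalarTower FinModule.finite

/-- The character of an `H`-module `V`: `h ↦ tr_V (x ↦ h • x)`. -/
def character (V : Type*) [AddCommGroup V] [Module k V] [Module H V] [IsScalarTower k H V] :
    Module.Dual k H :=
  LinearMap.trace k V ∘ₗ (Algebra.lsmul k k V : H →ₐ[k] Module.End k V).toLinearMap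

/-- The subgroup generated by `[M] - [L] - [N]` for all short exact sequences
`0 → L → M → N → 0` of finite dimensional `H`-modules. -/
def exactRelations : AddSubgroup (FreeAbelianGroup (FinModule.{w, u} k H)) :=
  AddSubgroup.closure {x | ∃ (L M N : FinModule.{w, u} k H)
    (f : L.carrier →ₗ[H] M.carrier) (g : M.carrier →ₗ[H] N.carrier),
    Function.Injective f ∧ Function.Surjective g ∧ Function.Exact f g ∧
    x = FreeAbelianGroup.of M - FreeAbelianGroup.of L - FreeAbelianGroup.of N}

/-- The Grothendieck group `G₀(H)` of finite dimensional `H`-modules. -/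
abbrev G0 : Type (max w (u + 1)) :=
  FreeAbelianGroup (FinModule.{w, u} k H) ⧸ exactRelations.{w, u} k H

/-- The scalar extension `G₀(H) ⊗_ℤ k` (with `k` written on the left). -/
abbrev G0k : Type (max w (u + 1)) := k ⊗[ℤ] G0.{w, u} k H

/-- The class `[V]` in `G₀(H) ⊗_ℤ k` of a finite dimensional `H`-module `V`. -/
def cls (V : Type u) [AddCommGroup V] [Module k V] [Module H V] [IsScalarTower k H V]
    [Module.Finite k V] : G0k.{w, u} k H :=
  (1 : k) ⊗ₜ[ℤ] (QuotientAddGroup.mk (FreeAbelianGroup.of (FinModule.mk V)))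

/-- The additive map `G₀(H) → H*`, `[V] ↦ χ_V`. -/
def characterHom : G0.{w, u} k H →+ Module.Dual k H :=
  QuotientAddGroup.lift (exactRelations.{w, u} k H)
    (FreeAbelianGroup.lift fun M => character k H M.carrier) (by
      rw [exactRelations, AddSubgroup.closure_le]
      rintro x ⟨L, M, N, f, g, hf, hg, hfg, rfl⟩
      simp only [SetLike.mem_coe, AddMonoidHom.mem_ker, map_sub, FreeAbelianGroup.lift_apply_of]
      rw [sub_sub, sub_eq_zero]
      ext h
      exact trace_of_exact (f.restrictScalars k) (g.restrictScalars k) hf hg hfg _ _ _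
        (by ext x; simp) (by ext x; simp))

/-- The `k`-linear map `G₀(H) ⊗_ℤ k → H*` with `[V] ⊗ a ↦ a χ_V`, through which elements of
`G₀(H) ⊗_ℤ k` are regarded as linear functions on `H`. -/
def characterMap : G0k.{w, u} k H →ₗ[k] Module.Dual k H :=
  LinearMap.liftBaseChange k (characterHom.{w, u} k H).toIntLinearMap

theorem characterMap_cls (V : Type u) [AddCommGroup V] [Module k V] [Module H V]
    [IsScalarTower k H V] [Module.Finite k V] :
    characterMap.{w, u} k H (cls.{w, u} k H V) = character k H V := by
  simp [characterMap, cls, characterHom]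

end Modules

section Hopf

variable {k : Type w} [Field k] {H : Type u} [Ring H] [HopfAlgebra k H]

/-- `Λ ∈ H` is a left integral: `h Λ = ε(h) Λ` for all `h`. -/
def IsLeftIntegral (k : Type w) [Field k] {H : Type u} [Ring H] [HopfAlgebra k H] (Λ : H) : Prop :=
  ∀ h : H, h * Λ = (Coalgebra.counit h : k) • Λ

/-- The function `f ⊗ g` on `H ⊗ H`. -/
def tensorEval (f g : Module.Dual k H) : Module.Dual k (H ⊗[k] H) :=
  TensorProduct.dualDistrib k H H (f ⊗ₜ[k] g)

/-- The convolution product on `H*`: `(f ∗ g)(h) = (f ⊗ g)(Δ(h))`. -/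
def conv (f g : Module.Dual k H) : Module.Dual k H :=
  tensorEval f g ∘ₗ Coalgebra.comul

/-- `lam ∈ H*` is a right integral: `lam ∗ f = f(1) lam` for all `f` in `H*`. -/
def IsRightIntegral (lam : Module.Dual k H) : Prop :=
  ∀ f : Module.Dual k H, conv lam f = f 1 • lam

/-- The element `u = S(Λ₍₂₎) Λ₍₁₎`. -/
def uElt (k : Type w) [Field k] {H : Type u} [Ring H] [HopfAlgebra k H] (Λ : H) : H :=
  LinearMap.mul' k H (TensorProduct.map (HopfAlgebra.antipode k) LinearMap.id
    (TensorProduct.comm k H H (Coalgebra.comul Λ)))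

/-- The element `v = (u / s) ∑ᵢ (rᵢ / dᵢ) eᵢ`, where `s` stands for `√ε(Λ)`, `rᵢ` for `√λ(eᵢ)`
and `dᵢ` for the dimension of the `i`-th simple module. -/
def vElt {ι : Type*} [Fintype ι] (Λ : H) (e : ι → H) (d : ι → ℕ) (s : k) (r : ι → k) : H :=
  (s⁻¹ • uElt k Λ) * ∑ i, (r i / (d i : k)) • e i

/-- `(f ⋆ g)(h) = (f ⊗ g)(Δ(h) Δ(v⁻¹) (v ⊗ v))`. -/
def star (v : H) (f g : Module.Dual k H) : Module.Dual k H :=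
  tensorEval f g ∘ₗ
    LinearMap.mulRight k (Coalgebra.comul (R := k) (Ring.inverse v) * (v ⊗ₜ[k] v)) ∘ₗ
    Coalgebra.comul

theorem star_apply (v : H) (f g : Module.Dual k H) (h : H) :
    star v f g h = tensorEval f g
      (Coalgebra.comul h * Coalgebra.comul (Ring.inverse v) * (v ⊗ₜ[k] v)) := by
  simp [star, mul_assoc]

end Hopf

end HopfStar

end

/-! Since `Δ` is multiplicative, `f ⋆ g` is the convolution of `f(- v)` and `g(- v)`, composed with
right multiplication by `v⁻¹`. So for any unit `v`, `⋆` is convolution transported along a linear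
automorphism of `H*`: it is associative on all of `H*`, and `ε` acts on either side as the scalar
`ε(v) = s r₀`.

What needs proof is that `⋆` preserves characters and that `v` is invertible. As `dᵢ² ≤ dim H < p²`,
no `dᵢ` vanishes in `k`, so the image of `G₀(H) ⊗ k` in `H*` is exactly the space of trace
functions. By semisimplicity `Λ` is a two-sided integral, whence `u h = S²(h) u` (`uElt_mul`). The
same holds for `v`, a central multiple of `u`. Hence `Δ(v⁻¹)(v ⊗ v)` commutes with `Δ(H)`, and `⋆`
preserves trace functions (`star_mul_comm`).

Invertibility of `u` follows from `lam(a u) = tr(L_a)`, with `L_a` left multiplication by `a`, and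
nondegeneracy of the regular trace form. Invertibility of the central factor means `lam(eᵢ) ≠ 0`
(`integral_idempotent_ne_zero`), which rests on the centrality of `S(u) u`. If `S² = id`, then `u =
ε(Λ) 1` and `ε(Λ) lam(eᵢ) = dᵢ²`, so the normalized roots give `v = 1`. -/

noncomputable section

namespace HopfStar

/-! ### Convolution inverses and the antipode -/

section Sweedler

open Coalgebra HopfAlgebra WithConv Algebra.TensorProduct

variable {k : Type w} [Field k] {H : Type u} [Ring H] [HopfAlgebra k H]

/-- Factors `Δ` into algebra maps, each of which is convolution invertible through the antipode. -/
theorem convMul_includeLeft_includeRight :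
    toConv ((includeLeft : H →ₐ[k] H ⊗[k] H).toLinearMap) *
      toConv ((includeRight : H →ₐ[k] H ⊗[k] H).toLinearMap) =
      toConv (comul : H →ₗ[k] H ⊗[k] H) := by
  apply WithConv.ext
  ext h
  change LinearMap.mul' k (H ⊗[k] H) (TensorProduct.map _ _ (comul h)) = comul h
  generalize (comul h : H ⊗[k] H) = X
  induction X with
  | zero => simp
  | tmul x y => simp
  | add x y hx hy => rw [map_add, map_add, hx, hy]

/-- An algebra map composed with the antipode is a left convolution inverse of the algebra map. -/
theorem algHom_antipode_convMul {A : Type*} [Ring A] [Algebra k A] (f : H →ₐ[k] A) :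
    toConv (f.toLinearMap ∘ₗ antipode k) * toConv f.toLinearMap = 1 := by
  have := LinearMap.algHom_comp_convMul_distrib f (toConv (antipode k (A := H)))
    (toConv LinearMap.id)
  rw [LinearMap.antipode_mul_id] at this
  apply WithConv.ext
  refine Eq.trans this.symm ?_
  ext h
  simp [LinearMap.convOne_def]

theorem algHom_convMul_antipode {A : Type*} [Ring A] [Algebra k A] (f : H →ₐ[k] A) :
    toConv f.toLinearMap * toConv (f.toLinearMap ∘ₗ antipode k) = 1 := by
  have := LinearMap.algHom_comp_convMul_distrib f (toConv LinearMap.id)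
    (toConv (antipode k (A := H)))
  rw [LinearMap.id_mul_antipode] at this
  apply WithConv.ext
  refine Eq.trans this.symm ?_
  ext h
  simp [LinearMap.convOne_def]

/-- Both sides are convolution inverses of `Δ`: the right side is a left inverse by the
factorization of `Δ`, and inverses are unique. -/
theorem comul_comp_antipode :
    (comul : H →ₗ[k] H ⊗[k] H) ∘ₗ antipode k =
      TensorProduct.map (antipode k) (antipode k) ∘ₗ
        (TensorProduct.comm k H H).toLinearMap ∘ₗ comul := by
  have hG : toConv (TensorProduct.map (antipode k) (antipode k) ∘ₗ
        (TensorProduct.comm k H H).toLinearMap ∘ₗ (comul : H →ₗ[k] H ⊗[k] H)) =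
      toConv ((includeRight : H →ₐ[k] H ⊗[k] H).toLinearMap ∘ₗ antipode k) *
        toConv ((includeLeft : H →ₐ[k] H ⊗[k] H).toLinearMap ∘ₗ antipode k) := by
    apply WithConv.ext
    ext h
    change TensorProduct.map (antipode k) (antipode k) (TensorProduct.comm k H H (comul h)) =
      LinearMap.mul' k (H ⊗[k] H) (TensorProduct.map _ _ (comul h))
    generalize (comul h : H ⊗[k] H) = X
    induction X with
    | zero => simp
    | tmul x y => simp
    | add x y hx hy => simp only [map_add, hx, hy]
  apply toConv_injective
  symm
  refine left_inv_eq_right_inv (a := toConv comul) ?_ LinearMap.comul_right_inv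
  rw [hG, ← convMul_includeLeft_includeRight, mul_assoc,
    ← mul_assoc (toConv ((includeLeft : H →ₐ[k] H ⊗[k] H).toLinearMap ∘ₗ antipode k)),
    algHom_antipode_convMul, one_mul, algHom_antipode_convMul]

theorem comul_antipode_antipode (h : H) :
    (comul (antipode k (antipode k h)) : H ⊗[k] H) =
      TensorProduct.map (antipode k ∘ₗ antipode k) (antipode k ∘ₗ antipode k) (comul h) := by
  have key : ∀ x : H, (comul (antipode k x) : H ⊗[k] H) =
      TensorProduct.map (antipode k) (antipode k) (TensorProduct.comm k H H (comul x)) :=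
    fun x => LinearMap.congr_fun comul_comp_antipode x
  rw [key, key]
  generalize (comul h : H ⊗[k] H) = X
  induction X with
  | zero => simp
  | tmul x y => simp
  | add x y hx hy => simp only [map_add, hx, hy]

/-- `∑ Δ(h₍₁₎) (1 ⊗ S(h₍₂₎)) = h ⊗ 1`. -/
theorem sum_comul_mul_antipode (h : H) :
    ∑ i ∈ (ℛ k h).index, (comul ((ℛ k h).left i) : H ⊗[k] H) *
      (1 ⊗ₜ[k] antipode k ((ℛ k h).right i)) = h ⊗ₜ[k] 1 := by
  have : toConv (comul : H →ₗ[k] H ⊗[k] H) *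
      toConv ((includeRight : H →ₐ[k] H ⊗[k] H).toLinearMap ∘ₗ antipode k) =
      toConv ((includeLeft : H →ₐ[k] H ⊗[k] H).toLinearMap) := by
    rw [← convMul_includeLeft_includeRight, mul_assoc, algHom_convMul_antipode, mul_one]
  have h2 := LinearMap.congr_fun (congrArg WithConv.ofConv this) h
  refine Eq.trans ?_ h2
  exact ((ℛ k h).convMul_apply (toConv (comul : H →ₗ[k] H ⊗[k] H))
    (toConv ((includeRight : H →ₐ[k] H ⊗[k] H).toLinearMap ∘ₗ antipode k))).symm

end Sweedler

/-! ### Integrals, the element `u` and dual bases -/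

section Integrals

open Coalgebra HopfAlgebra

variable {k : Type w} [Field k] {H : Type u} [Ring H] [HopfAlgebra k H]

/-- A right integral `Λ ∈ H` satisfies `Δ(Λ) (h ⊗ 1) = Δ(Λ) (1 ⊗ S(h))`. -/
theorem comul_mul_tmul_one {Λ : H} (hΛ : ∀ h : H, Λ * h = (counit h : k) • Λ) (h : H) :
    (comul Λ : H ⊗[k] H) * (h ⊗ₜ[k] 1) = comul Λ * (1 ⊗ₜ[k] antipode k h) := by
  rw [← sum_comul_mul_antipode h, Finset.mul_sum]
  simp_rw [← mul_assoc, ← Bialgebra.comul_mul, hΛ, map_smul, smul_mul_assoc]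
  simp_rw [← mul_smul_comm, ← TensorProduct.tmul_smul, ← map_smul]
  rw [← Finset.mul_sum, ← TensorProduct.tmul_sum, ← map_sum, sum_counit_smul]

/-- Under `x ⊗ y ↦ S(y) x`, right multiplication by `h ⊗ 1` becomes right multiplication by `h`, and
right multiplication by `1 ⊗ S(h)` becomes left multiplication by `S²(h)`. The two agree on `Δ(Λ)`.
-/
theorem uElt_mul {Λ : H} (hΛ : ∀ h : H, Λ * h = (counit h : k) • Λ) (h : H) :
    uElt k Λ * h = antipode k (antipode k h) * uElt k Λ := by
  have h1 : ∀ X : H ⊗[k] H, LinearMap.mul' k H (TensorProduct.map (antipode k) LinearMap.id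
      (TensorProduct.comm k H H (X * (h ⊗ₜ[k] 1)))) =
      LinearMap.mul' k H (TensorProduct.map (antipode k) LinearMap.id
        (TensorProduct.comm k H H X)) * h := by
    intro X
    induction X with
    | zero => simp
    | tmul x y => simp [mul_assoc]
    | add x y hx hy => simp only [add_mul, map_add, hx, hy]
  have h2 : ∀ X : H ⊗[k] H, LinearMap.mul' k H (TensorProduct.map (antipode k) LinearMap.id
      (TensorProduct.comm k H H (X * (1 ⊗ₜ[k] antipode k h)))) =
      antipode k (antipode k h) * LinearMap.mul' k H (TensorProduct.map (antipode k) LinearMap.id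
        (TensorProduct.comm k H H X)) := by
    intro X
    induction X with
    | zero => simp
    | tmul x y => simp [mul_assoc, antipode_mul_antidistrib]
    | add x y hx hy => simp only [mul_add, add_mul, map_add, hx, hy]
  rw [uElt, ← h1, ← h2, comul_mul_tmul_one hΛ]

theorem uElt_eq_sum (Λ : H) :
    uElt k Λ = ∑ i ∈ (ℛ k Λ).index, antipode k ((ℛ k Λ).right i) * (ℛ k Λ).left i := by
  rw [uElt]
  conv_lhs => rw [← (ℛ k Λ).eq]
  simp

/-- A trace function takes the value `ε(Λ) f(1)` at `u`. -/
theorem traceFunction_uElt {f : Module.Dual k H} (hf : ∀ a b, f (a * b) = f (b * a)) (Λ : H) :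
    f (uElt k Λ) = counit Λ * f 1 := by
  rw [uElt_eq_sum, map_sum]
  simp_rw [hf (antipode k _)]
  rw [← map_sum, sum_mul_antipode_eq_smul, map_smul, smul_eq_mul]

/-- Here `S(Λ₍₂₎) Λ₍₁₎ = S(S(Λ₍₁₎) Λ₍₂₎)`. -/
theorem uElt_of_antipode_antipode (hS : ∀ h : H, antipode k (antipode k h) = h) (Λ : H) :
    uElt k Λ = (counit Λ : k) • 1 := by
  rw [uElt_eq_sum]
  calc _ = ∑ i ∈ (ℛ k Λ).index,
        antipode k (antipode k ((ℛ k Λ).left i) * (ℛ k Λ).right i) := by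
        simp_rw [antipode_mul_antidistrib, hS]
    _ = _ := by rw [← map_sum, sum_antipode_mul_eq_smul, map_smul, antipode_one]

theorem counit_uElt (Λ : H) : (counit (uElt k Λ) : k) = counit Λ := by
  rw [traceFunction_uElt (f := counit) (fun a b => by
    rw [Bialgebra.counit_mul, Bialgebra.counit_mul, mul_comm]), Bialgebra.counit_one, mul_one]

/-- The function `lam ⊗ id : H ⊗ H → H`. -/
def contractLeft (lam : Module.Dual k H) : H ⊗[k] H →ₗ[k] H :=
  TensorProduct.lid k H ∘ₗ TensorProduct.map lam LinearMap.id

@[simp]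
theorem contractLeft_tmul (lam : Module.Dual k H) (x y : H) :
    contractLeft lam (x ⊗ₜ[k] y) = lam x • y := by
  simp [contractLeft]

theorem contractLeft_mul_one_tmul (lam : Module.Dual k H) (X : H ⊗[k] H) (y : H) :
    contractLeft lam (X * (1 ⊗ₜ[k] y)) = contractLeft lam X * y := by
  induction X with
  | zero => simp
  | tmul x y => simp
  | add x y hx hy => rw [add_mul, map_add, map_add, hx, hy, add_mul]

/-- A right integral satisfies `lam(h₍₁₎) h₍₂₎ = lam(h) 1`. -/
theorem IsRightIntegral.contractLeft_comul {lam : Module.Dual k H} (hlam : IsRightIntegral lam)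
    (h : H) : contractLeft lam (comul h) = lam h • 1 := by
  rw [← sub_eq_zero, ← Module.forall_dual_apply_eq_zero_iff k]
  intro f
  have h1 : ∀ X : H ⊗[k] H, f (contractLeft lam X) = tensorEval lam f X := by
    intro X
    induction X with
    | zero => simp
    | tmul x y => simp [tensorEval]
    | add x y hx hy => rw [map_add, map_add, map_add, hx, hy]
  have h2 := LinearMap.congr_fun (hlam f) h
  rw [map_sub, h1, map_smul, sub_eq_zero]
  exact h2.trans (mul_comm _ _)

/-- `lam(a₍₁₎ b) a₍₂₎ = lam(a b₍₁₎) S(b₍₂₎)` for a right integral `lam`. -/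
theorem IsRightIntegral.contractLeft_comul_mul {lam : Module.Dual k H}
    (hlam : IsRightIntegral lam) (a b : H) :
    contractLeft lam (comul a * (b ⊗ₜ[k] 1)) =
      ∑ i ∈ (ℛ k b).index, lam (a * (ℛ k b).left i) • antipode k ((ℛ k b).right i) := by
  rw [← sum_comul_mul_antipode b, Finset.mul_sum, map_sum]
  refine Finset.sum_congr rfl fun i _ => ?_
  rw [← mul_assoc, ← Bialgebra.comul_mul, contractLeft_mul_one_tmul, hlam.contractLeft_comul,
    smul_mul_assoc, one_mul]

/-- The functions `lam(- Λ₍₁₎)` and the elements `S(Λ₍₂₎)` are dual bases of `H`. -/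
theorem sum_integral_smul_antipode {lam : Module.Dual k H} (hlam : IsRightIntegral lam) {Λ : H}
    (hΛ : IsLeftIntegral k Λ) (hlamΛ : lam Λ = 1) (a : H) :
    ∑ i ∈ (ℛ k Λ).index, lam (a * (ℛ k Λ).left i) • antipode k ((ℛ k Λ).right i) = a := by
  rw [← hlam.contractLeft_comul_mul]
  conv_lhs => rw [← (ℛ k a).eq]
  simp only [Finset.sum_mul, Algebra.TensorProduct.tmul_mul_tmul, mul_one, map_sum,
    contractLeft_tmul]
  -- The left side is `lam(a₍₁₎ Λ) a₍₂₎`, and `a₍₁₎ Λ = ε(a₍₁₎) Λ`.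
  simp_rw [hΛ _, map_smul, hlamΛ, smul_eq_mul, mul_one]
  exact sum_counit_smul (ℛ k a)

theorem antipode_surjective {lam : Module.Dual k H} (hlam : IsRightIntegral lam) {Λ : H}
    (hΛ : IsLeftIntegral k Λ) (hlamΛ : lam Λ = 1) :
    Function.Surjective (antipode k : H →ₗ[k] H) := fun a =>
  ⟨∑ i ∈ (ℛ k Λ).index, lam (a * (ℛ k Λ).left i) • (ℛ k Λ).right i, by
    simp_rw [map_sum, map_smul]; exact sum_integral_smul_antipode hlam hΛ hlamΛ a⟩

/-- `lam(a u)` is the trace of the left multiplication by `a`. -/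
theorem integral_mul_uElt [Module.Finite k H] {lam : Module.Dual k H} (hlam : IsRightIntegral lam)
    {Λ : H} (hΛ : IsLeftIntegral k Λ) (hlamΛ : lam Λ = 1) (a : H) :
    lam (a * uElt k Λ) = LinearMap.trace k H (LinearMap.mulLeft k a) := by
  -- The dual bases write left multiplication as a sum of rank-one maps, whose traces are `lam(a
  -- S(Λ₍₂₎) Λ₍₁₎)`.
  have : LinearMap.mulLeft k a = ∑ i ∈ (ℛ k Λ).index,
      (lam ∘ₗ LinearMap.mulRight k ((ℛ k Λ).left i)).smulRight
        (a * antipode k ((ℛ k Λ).right i)) := by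
    ext x
    simp only [LinearMap.mulLeft_apply, LinearMap.coe_sum, Finset.sum_apply,
      LinearMap.smulRight_apply, LinearMap.comp_apply, LinearMap.mulRight_apply]
    conv_lhs => rw [← sum_integral_smul_antipode hlam hΛ hlamΛ x]
    simp only [Finset.mul_sum, mul_smul_comm]
  rw [this, map_sum, uElt_eq_sum, Finset.mul_sum, map_sum]
  refine Finset.sum_congr rfl fun i _ => ?_
  rw [LinearMap.trace_smulRight]
  simp [mul_assoc]

end Integrals

/-! ### The operation `⋆` on `H*` -/

section Star

open Coalgebra HopfAlgebra

variable {k : Type w} [Field k] {H : Type u} [Ring H] [HopfAlgebra k H]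

@[simp]
theorem tensorEval_tmul (f g : Module.Dual k H) (x y : H) :
    tensorEval f g (x ⊗ₜ[k] y) = f x * g y := by
  simp [tensorEval]

theorem conv_eq_convMul (f g : Module.Dual k H) :
    conv f g = (WithConv.toConv f * WithConv.toConv g).ofConv := by
  ext h
  change tensorEval f g (comul h) = LinearMap.mul' k k (TensorProduct.map f g (comul h))
  generalize (comul h : H ⊗[k] H) = X
  induction X with
  | zero => simp
  | tmul x y => simp
  | add x y hx hy => rw [map_add, map_add, map_add, hx, hy]

theorem conv_assoc (f g h : Module.Dual k H) : conv (conv f g) h = conv f (conv g h) := by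
  simp only [conv_eq_convMul, WithConv.toConv_ofConv, mul_assoc]

theorem counit_conv (f : Module.Dual k H) : conv counit f = f := by
  rw [conv_eq_convMul]
  exact congrArg WithConv.ofConv (one_mul (WithConv.toConv f))

theorem conv_counit (f : Module.Dual k H) : conv f counit = f := by
  rw [conv_eq_convMul]
  exact congrArg WithConv.ofConv (mul_one (WithConv.toConv f))

theorem conv_smul_left (c : k) (f g : Module.Dual k H) : conv (c • f) g = c • conv f g := by
  simp only [conv_eq_convMul]
  exact congrArg WithConv.ofConv (smul_mul_assoc c (WithConv.toConv f) (WithConv.toConv g))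

theorem conv_smul_right (c : k) (f g : Module.Dual k H) : conv f (c • g) = c • conv f g := by
  simp only [conv_eq_convMul]
  exact congrArg WithConv.ofConv (mul_smul_comm c (WithConv.toConv f) (WithConv.toConv g))

/-- The operation `⋆` is the convolution, transported along the right multiplication by `v`. -/
theorem star_eq_conv (v : H) (f g : Module.Dual k H) :
    star v f g = conv (f ∘ₗ LinearMap.mulRight k v) (g ∘ₗ LinearMap.mulRight k v) ∘ₗ
      LinearMap.mulRight k (Ring.inverse v) := by
  ext h
  rw [star_apply, ← Bialgebra.comul_mul]
  simp only [conv, LinearMap.comp_apply, LinearMap.mulRight_apply]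
  generalize (comul (h * Ring.inverse v) : H ⊗[k] H) = X
  induction X with
  | zero => simp
  | tmul x y => simp
  | add x y hx hy => rw [add_mul, map_add, map_add, hx, hy]

theorem star_comp_mulRight {v : H} (hv : IsUnit v) (f g : Module.Dual k H) :
    star v f g ∘ₗ LinearMap.mulRight k v =
      conv (f ∘ₗ LinearMap.mulRight k v) (g ∘ₗ LinearMap.mulRight k v) := by
  rw [star_eq_conv]
  ext h
  simp [mul_assoc, Ring.mul_inverse_cancel v hv]

theorem star_assoc {v : H} (hv : IsUnit v) (f g h : Module.Dual k H) :
    star v (star v f g) h = star v f (star v g h) := by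
  rw [star_eq_conv v (star v f g), star_eq_conv v f (star v g h), star_comp_mulRight hv,
    star_comp_mulRight hv, conv_assoc]

theorem counit_comp_mulRight (v : H) :
    (counit : H →ₗ[k] k) ∘ₗ LinearMap.mulRight k v = (counit v : k) • counit := by
  ext h
  simp [mul_comm]

theorem counit_star {v : H} (hv : IsUnit v) (f : Module.Dual k H) :
    star v counit f = (counit v : k) • f := by
  rw [star_eq_conv, counit_comp_mulRight, conv_smul_left, counit_conv]
  ext h
  simp [mul_assoc, Ring.inverse_mul_cancel v hv]

theorem star_counit {v : H} (hv : IsUnit v) (f : Module.Dual k H) :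
    star v f counit = (counit v : k) • f := by
  rw [star_eq_conv, counit_comp_mulRight, conv_smul_right, conv_counit]
  ext h
  simp [mul_assoc, Ring.inverse_mul_cancel v hv]

theorem star_one (f g : Module.Dual k H) : star 1 f g = conv f g := by
  rw [star_eq_conv]
  simp

/-- `⋆` as a bilinear map. -/
def starBilin (v : H) : Module.Dual k H →ₗ[k] Module.Dual k H →ₗ[k] Module.Dual k H :=
  LinearMap.mk₂ k (star v)
    (fun f₁ f₂ g => by ext h; simp [star, tensorEval, TensorProduct.add_tmul])
    (fun c f g => by ext h; simp [star, tensorEval, ← TensorProduct.smul_tmul'])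
    (fun f g₁ g₂ => by ext h; simp [star, tensorEval, TensorProduct.tmul_add])
    (fun c f g => by ext h; simp [star, tensorEval])

theorem tensorEval_mul_comm {f g : Module.Dual k H} (hf : ∀ a b, f (a * b) = f (b * a))
    (hg : ∀ a b, g (a * b) = g (b * a)) (X Y : H ⊗[k] H) :
    tensorEval f g (X * Y) = tensorEval f g (Y * X) := by
  induction X with
  | zero => simp
  | add x y hx hy => rw [add_mul, mul_add, map_add, map_add, hx, hy]
  | tmul a b =>
    induction Y with
    | zero => simp
    | add x y hx hy => rw [add_mul, mul_add, map_add, map_add, hx, hy]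
    | tmul c d => simp [hf a c, hg b d]

/-- If conjugation by `v` is the square of the antipode, then `⋆` preserves trace functions. -/
theorem star_mul_comm {v : H} (hv : IsUnit v)
    (hvS : ∀ h, v * h = antipode k (antipode k h) * v) {f g : Module.Dual k H}
    (hf : ∀ a b, f (a * b) = f (b * a)) (hg : ∀ a b, g (a * b) = g (b * a)) (a b : H) :
    star v f g (a * b) = star v f g (b * a) := by
  have hvS' : b * Ring.inverse v = Ring.inverse v * antipode k (antipode k b) := by
    rw [← hv.mul_right_inj, ← mul_assoc, hvS, mul_assoc, Ring.mul_inverse_cancel v hv,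
      ← mul_assoc, Ring.mul_inverse_cancel v hv, mul_one, one_mul]
  have hcomul : ∀ X : H ⊗[k] H, TensorProduct.map (antipode k ∘ₗ antipode k)
      (antipode k ∘ₗ antipode k) X * (v ⊗ₜ[k] v) = (v ⊗ₜ[k] v) * X := by
    intro X
    induction X with
    | zero => simp
    | tmul x y => simp [hvS]
    | add x y hx hy => rw [map_add, add_mul, mul_add, hx, hy]
  -- Moving `Δ(b)` past `Δ(v⁻¹)` turns it into `Δ(S²(b)) = (S² ⊗ S²)Δ(b)`, and moving past `v ⊗ v`
  -- restores `Δ(b)`.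
  have hJ : (comul b : H ⊗[k] H) * (comul (Ring.inverse v) * (v ⊗ₜ[k] v)) =
      (comul (Ring.inverse v) * (v ⊗ₜ[k] v)) * comul b := by
    rw [← mul_assoc, ← Bialgebra.comul_mul, hvS', Bialgebra.comul_mul, mul_assoc,
      comul_antipode_antipode, hcomul, mul_assoc]
  rw [star_apply, star_apply, Bialgebra.comul_mul, Bialgebra.comul_mul]
  simp only [mul_assoc]
  rw [hJ, ← mul_assoc, tensorEval_mul_comm hf hg]

end Star

/-! ### Simple modules, block idempotents and trace functions -/

section Semisimple

theorem exists_dual_eq_one (k : Type*) [Field k] (V : Type*) [AddCommGroup V] [Module k V]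
    [Nontrivial V] : ∃ (φ : Module.Dual k V) (x : V), φ x = 1 := by
  obtain ⟨x, hx⟩ := exists_ne (0 : V)
  obtain ⟨φ, hφ⟩ := Module.Projective.exists_dual_ne_zero k hx
  exact ⟨φ, (φ x)⁻¹ • x, by simp [hφ]⟩

/-- A linear function `g` on `End V` with `g (A * B) = g (B * A)` is a multiple of the trace. -/
theorem exists_eq_mul_trace {k : Type*} [Field k] {V : Type*} [AddCommGroup V] [Module k V]
    [Module.Finite k V] [Nontrivial V] (g : Module.Dual k (Module.End k V))
    (hg : ∀ A B, g (A * B) = g (B * A)) : ∃ c, ∀ A, g A = c * LinearMap.trace k V A := by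
  obtain ⟨φ, x, hφ⟩ := exists_dual_eq_one k V
  refine ⟨g (φ.smulRight x), fun A => ?_⟩
  -- Rank-one maps factor through the fixed vector `x`; swapping the factors leaves the scalar `ψ y`
  -- times one fixed map.
  have key : ∀ (ψ : Module.Dual k V) (y : V),
      g (ψ.smulRight y) = g (φ.smulRight x) * ψ y := by
    intro ψ y
    have h1 : (ψ.smulRight y : Module.End k V) = φ.smulRight y * ψ.smulRight x := by
      ext z; simp [hφ]
    have h2 : (ψ.smulRight x * φ.smulRight y : Module.End k V) = ψ y • φ.smulRight x := by
      ext z; simp [smul_smul, mul_comm]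
    rw [h1, hg, h2, map_smul, smul_eq_mul, mul_comm]
  let b := Module.finBasis k V
  have hA : A = ∑ i, (b.coord i).smulRight (A (b i)) := by
    ext z
    conv_lhs => rw [← b.sum_repr z]
    simp only [map_sum, map_smul, LinearMap.coe_sum, Finset.sum_apply,
      LinearMap.smulRight_apply, Module.Basis.coord_apply]
  rw [hA, map_sum, map_sum, Finset.mul_sum]
  exact Finset.sum_congr rfl fun i _ => by rw [key, LinearMap.trace_smulRight]

variable {k : Type w} [Field k] {H : Type u} [Ring H] [Algebra k H]

/-- The algebra map `H → End V` of an absolutely simple module is surjective. -/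
theorem lsmul_surjective [IsAlgClosed k] (V : Type*) [AddCommGroup V] [Module k V] [Module H V]
    [IsScalarTower k H V] [Module.Finite k V] [IsSimpleModule H V] :
    Function.Surjective (Algebra.lsmul k k V : H →ₐ[k] Module.End k V) := by
  intro A
  have hschur := (IsSimpleModule.algebraMap_end_bijective_of_isAlgClosed
    (A := H) (V := V) k).2
  -- By Schur's lemma `End_H V = k`, so any `k`-linear `A` lies in the bicommutant and the density
  -- theorem applies.
  let f : Module.End (Module.End H V) V :=
    { toFun := A
      map_add' := map_add A
      map_smul' := fun T x => by
        obtain ⟨c, rfl⟩ := hschur T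
        simp }
  obtain ⟨s, hs⟩ := Module.Finite.fg_top (R := k) (M := V)
  obtain ⟨h, hh⟩ := jacobson_density f s
  refine ⟨h, LinearMap.ext_on hs fun x hx => ?_⟩
  simpa [f] using (hh x hx).symm

theorem finrank_sq_le [IsAlgClosed k] [Module.Finite k H] (V : Type*) [AddCommGroup V]
    [Module k V] [Module H V] [IsScalarTower k H V] [Module.Finite k V] [IsSimpleModule H V] :
    Module.finrank k V ^ 2 ≤ Module.finrank k H := by
  have := LinearMap.finrank_le_finrank_of_surjective
    (f := (Algebra.lsmul k k V : H →ₐ[k] Module.End k V).toLinearMap) (lsmul_surjective V)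
  rwa [Module.finrank_linearMap, ← sq] at this

/-- The bound on `p` enters here: `0 < d` and `d² ≤ dim H < p²` give `0 < d < p`. -/
theorem finrank_cast_ne_zero [IsAlgClosed k] [Module.Finite k H] (V : Type*) [AddCommGroup V]
    [Module k V] [Module H V] [IsScalarTower k H V] [Module.Finite k V] [IsSimpleModule H V]
    (p : ℕ) [CharP k p] (hp : Module.finrank k H < p ^ 2) : (Module.finrank k V : k) ≠ 0 := by
  rw [Ne, CharP.cast_eq_zero_iff k p]
  have : Nontrivial V := IsSimpleModule.nontrivial H V
  exact Nat.not_dvd_of_pos_of_lt Module.finrank_pos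
    (lt_of_pow_lt_pow_left₀ 2 (Nat.zero_le _) ((finrank_sq_le (H := H) V).trans_lt hp))

@[simp]
theorem character_apply (V : Type*) [AddCommGroup V] [Module k V] [Module H V]
    [IsScalarTower k H V] (h : H) :
    character k H V h = LinearMap.trace k V (Algebra.lsmul k k V h) := rfl

theorem character_mul_comm (V : Type*) [AddCommGroup V] [Module k V] [Module H V]
    [IsScalarTower k H V] (a b : H) : character k H V (a * b) = character k H V (b * a) := by
  simp only [character_apply, map_mul]
  exact LinearMap.trace_mul_comm k _ _

theorem character_one (V : Type*) [AddCommGroup V] [Module k V] [Module H V]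
    [IsScalarTower k H V] [Module.Finite k V] : character k H V 1 = Module.finrank k V := by
  rw [character_apply, map_one, LinearMap.trace_one]

/-- An element of a semisimple ring that annihilates all simple modules is zero. -/
theorem eq_zero_of_smul_eq_zero {H : Type u} [Ring H] [IsSemisimpleRing H] {ι : Type*}
    {V : ι → Type u} [∀ i, AddCommGroup (V i)] [∀ i, Module H (V i)]
    (hV_all : ∀ (W : Type u) [AddCommGroup W] [Module H W] [IsSimpleModule H W],
      ∃ i, Nonempty (W ≃ₗ[H] V i))
    {h : H} (hh : ∀ i (x : V i), h • x = 0) : h = 0 := by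
  -- `H` is the sum of its simple left ideals, each isomorphic to some `V i`; hence `h` kills `1`.
  have key : ∀ y ∈ sSup { m : Submodule H H | IsSimpleModule H m }, h * y = 0 := by
    intro y hy
    rw [sSup_eq_iSup'] at hy
    refine Submodule.iSup_induction _ (motive := fun y => h * y = 0) hy ?_ (mul_zero h)
      fun x y hx hy => by rw [mul_add, hx, hy, add_zero]
    intro m y hy
    have : IsSimpleModule H m.1 := m.2
    obtain ⟨i, ⟨φ⟩⟩ := hV_all m.1
    have h1 : h • (⟨y, hy⟩ : m.1) = 0 := φ.injective (by rw [map_smul, hh, map_zero])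
    simpa using congrArg Subtype.val h1
  simpa using key 1 (by rw [IsSemisimpleModule.sSup_simples_eq_top]; trivial)

/-- The elements `e i` act as the identity on `V i` and as zero on `V j` for `j ≠ i`, and only
zero annihilates all `V i`. -/
structure IsBlockSystem {H : Type u} [Ring H] {ι : Type*} (V : ι → Type u)
    [∀ i, AddCommGroup (V i)] [∀ i, Module H (V i)] (e : ι → H) : Prop where
  faithful : ∀ h : H, (∀ i (x : V i), h • x = 0) → h = 0
  smul_self : ∀ i (x : V i), e i • x = x
  smul_other : ∀ i j, j ≠ i → ∀ x : V j, e i • x = 0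

namespace IsBlockSystem

section Idempotents

variable {ι : Type*} {V : ι → Type u} [∀ i, AddCommGroup (V i)] [∀ i, Module H (V i)] {e : ι → H}

theorem ext (he : IsBlockSystem V e) {a b : H} (hab : ∀ i (x : V i), a • x = b • x) : a = b :=
  sub_eq_zero.mp (he.faithful _ fun i x => by rw [sub_smul, hab, sub_self])

theorem mul_comm (he : IsBlockSystem V e) (i : ι) (h : H) : e i * h = h * e i := by
  refine he.ext fun j x => ?_
  rw [mul_smul, mul_smul]
  by_cases hj : j = i
  · subst hj
    rw [he.smul_self, he.smul_self]
  · rw [he.smul_other i j hj, he.smul_other i j hj, smul_zero]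

theorem mul_self (he : IsBlockSystem V e) (i : ι) : e i * e i = e i := by
  refine he.ext fun j x => ?_
  rw [mul_smul]
  by_cases hj : j = i
  · subst hj
    rw [he.smul_self]
  · simp only [he.smul_other i j hj]

theorem mul_eq_zero_iff (he : IsBlockSystem V e) (i : ι) (a : H) :
    e i * a = 0 ↔ ∀ x : V i, a • x = 0 := by
  constructor
  · intro h x
    rw [← he.smul_self i (a • x), ← mul_smul, h, zero_smul]
  · intro h
    refine he.faithful _ fun j x => ?_
    rw [mul_smul]
    by_cases hj : j = i
    · subst hj
      rw [h, smul_zero]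
    · rw [he.smul_other i j hj]

theorem sum_smul_smul [Fintype ι] [∀ i, Module k (V i)] [∀ i, IsScalarTower k H (V i)]
    (he : IsBlockSystem V e) (c : ι → k) (i : ι) (x : V i) :
    (∑ j, c j • e j) • x = c i • x := by
  rw [Finset.sum_smul, Finset.sum_eq_single i]
  · rw [smul_assoc, he.smul_self]
  · intro j _ hj
    rw [smul_assoc, he.smul_other j i hj.symm, smul_zero]
  · simp

theorem sum_eq_one [Fintype ι] (he : IsBlockSystem V e) : ∑ i, e i = 1 := by
  refine he.ext fun i x => ?_
  rw [Finset.sum_smul, Finset.sum_eq_single i, he.smul_self, one_smul]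
  · intro j _ hj
    rw [he.smul_other j i hj.symm]
  · simp

end Idempotents

section Characters

variable {ι : Type*} {V : ι → Type u} [∀ i, AddCommGroup (V i)] [∀ i, Module k (V i)]
  [∀ i, Module H (V i)] [∀ i, IsScalarTower k H (V i)] {e : ι → H}

theorem character_mul_self (he : IsBlockSystem V e) (i : ι) (a : H) :
    character k H (V i) (e i * a) = character k H (V i) a := by
  rw [character_apply, character_apply]
  congr 1
  ext x
  simp [he.smul_self]

theorem character_mul_other (he : IsBlockSystem V e) {i j : ι} (hj : j ≠ i) (a : H) :
    character k H (V j) (e i * a) = 0 := by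
  rw [character_apply, show Algebra.lsmul k k (V j) (e i * a) = 0 from ?_, map_zero]
  ext x
  simp [he.smul_other i j hj]

theorem sum_mul_character [Fintype ι] (he : IsBlockSystem V e) (c : ι → k) (i : ι) (a : H) :
    ∑ j, c j * character k H (V j) (e i * a) = c i * character k H (V i) a := by
  rw [Finset.sum_eq_single i, he.character_mul_self]
  · intro j _ hj
    rw [he.character_mul_other hj, mul_zero]
  · simp

variable [IsAlgClosed k] [∀ i, Module.Finite k (V i)] [∀ i, IsSimpleModule H (V i)]

/-- The function `f(eᵢ -)` vanishes on the annihilator of `V i`, so it descends to a trace function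
on `End (V i)`, a multiple of the trace. Evaluation at `1` fixes the constant. -/
theorem finrank_mul_traceFunction (he : IsBlockSystem V e) {f : Module.Dual k H}
    (hf : ∀ a b, f (a * b) = f (b * a)) (i : ι) (a : H) :
    Module.finrank k (V i) * f (e i * a) = f (e i) * character k H (V i) a := by
  have : Nontrivial (V i) := IsSimpleModule.nontrivial H (V i)
  let Φ := (Algebra.lsmul k k (V i) : H →ₐ[k] Module.End k (V i))
  have hΦ : Function.Surjective Φ := lsmul_surjective (V i)
  obtain ⟨t, ht⟩ := Φ.toLinearMap.exists_rightInverse_of_surjective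
    (LinearMap.range_eq_top.mpr hΦ)
  let g : Module.Dual k (Module.End k (V i)) := f ∘ₗ LinearMap.mulLeft k (e i) ∘ₗ t
  have hg : ∀ a, g (Φ a) = f (e i * a) := by
    intro a
    have h1 : e i * (t (Φ a) - a) = 0 := by
      rw [he.mul_eq_zero_iff]
      intro x
      have h2 : Φ (t (Φ a)) x = Φ a x := by
        exact LinearMap.congr_fun (LinearMap.congr_fun ht (Φ a)) x
      rw [sub_smul, sub_eq_zero]
      exact h2
    rw [mul_sub, sub_eq_zero] at h1
    simp only [g, LinearMap.comp_apply, LinearMap.mulLeft_apply, h1]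
  obtain ⟨c, hc⟩ := exists_eq_mul_trace g (by
    intro A B
    obtain ⟨a, rfl⟩ := hΦ A
    obtain ⟨b, rfl⟩ := hΦ B
    rw [← map_mul, ← map_mul, hg, hg, ← mul_assoc, hf, ← mul_assoc, ← he.mul_comm i b, mul_assoc])
  have h1 : f (e i) = c * Module.finrank k (V i) := by
    rw [← mul_one (e i), ← hg, hc, map_one, LinearMap.trace_one]
  rw [h1, ← hg, hc, character_apply]
  ring

/-- Trace functions are linear combinations of the characters. -/
theorem traceFunction_eq [Fintype ι] (he : IsBlockSystem V e)
    (hd : ∀ i, (Module.finrank k (V i) : k) ≠ 0) {f : Module.Dual k H}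
    (hf : ∀ a b, f (a * b) = f (b * a)) :
    f = ∑ i, (f (e i) / Module.finrank k (V i)) • character k H (V i) := by
  ext a
  conv_lhs => rw [← one_mul a, ← he.sum_eq_one, Finset.sum_mul, map_sum]
  rw [LinearMap.sum_apply]
  refine Finset.sum_congr rfl fun i _ => ?_
  rw [LinearMap.smul_apply, smul_eq_mul, div_mul_eq_mul_div, eq_div_iff (hd i),
    ← he.finrank_mul_traceFunction hf, _root_.mul_comm]

variable [Module.Finite k H]

/-- The map is a projection whose kernel is the annihilator of `V i`, so its rank is `dim End (V
i)`. -/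
theorem trace_mulLeft_idempotent (he : IsBlockSystem V e) (i : ι) :
    LinearMap.trace k H (LinearMap.mulLeft k (e i)) = (Module.finrank k (V i) : k) ^ 2 := by
  have hproj : LinearMap.IsProj (LinearMap.range (LinearMap.mulLeft k (e i)))
      (LinearMap.mulLeft k (e i)) := by
    refine ⟨fun x => ⟨x, rfl⟩, ?_⟩
    rintro _ ⟨x, rfl⟩
    simp [← mul_assoc, he.mul_self]
  let Φ := (Algebra.lsmul k k (V i) : H →ₐ[k] Module.End k (V i)).toLinearMap
  have hker : LinearMap.ker (LinearMap.mulLeft k (e i)) = LinearMap.ker Φ := by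
    ext a
    rw [LinearMap.mem_ker, LinearMap.mem_ker, LinearMap.mulLeft_apply, he.mul_eq_zero_iff]
    exact ⟨fun h => LinearMap.ext h, fun h x => LinearMap.congr_fun h x⟩
  have h1 := LinearMap.finrank_range_add_finrank_ker (LinearMap.mulLeft k (e i))
  have h2 := LinearMap.finrank_range_add_finrank_ker Φ
  rw [LinearMap.range_eq_top (f := Φ).mpr (lsmul_surjective (V i)), finrank_top,
    Module.finrank_linearMap] at h2
  rw [hker] at h1
  rw [hproj.trace, Nat.add_right_cancel (h1.trans h2.symm), Nat.cast_mul, sq]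

theorem trace_mulLeft [Fintype ι] (he : IsBlockSystem V e)
    (hd : ∀ i, (Module.finrank k (V i) : k) ≠ 0) (a : H) :
    LinearMap.trace k H (LinearMap.mulLeft k a) =
      ∑ i, Module.finrank k (V i) * character k H (V i) a := by
  have h := he.traceFunction_eq hd (f := character k H H) (character_mul_comm H)
  have hlsmul : ∀ b, Algebra.lsmul k k H b = LinearMap.mulLeft k b := fun b => rfl
  rw [← hlsmul, ← character_apply, h, LinearMap.sum_apply]
  refine Finset.sum_congr rfl fun i _ => ?_
  rw [LinearMap.smul_apply, smul_eq_mul, character_apply H, hlsmul, he.trace_mulLeft_idempotent, sq,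
    mul_div_cancel_right₀ _ (hd i)]

theorem trace_mulLeft_mul [Fintype ι] (he : IsBlockSystem V e)
    (hd : ∀ i, (Module.finrank k (V i) : k) ≠ 0) (i : ι) (a : H) :
    LinearMap.trace k H (LinearMap.mulLeft k (e i * a)) =
      Module.finrank k (V i) * character k H (V i) a := by
  rw [he.trace_mulLeft hd, he.sum_mul_character]

/-- The trace form of the regular representation is nondegenerate. -/
theorem eq_zero_of_trace_mulLeft [Fintype ι] (he : IsBlockSystem V e)
    (hd : ∀ i, (Module.finrank k (V i) : k) ≠ 0) {c : H}
    (hc : ∀ a, LinearMap.trace k H (LinearMap.mulLeft k (a * c)) = 0) : c = 0 := by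
  refine he.faithful c fun i x => ?_
  rw [← Module.forall_dual_apply_eq_zero_iff k]
  intro φ
  -- With `a` acting as the rank-one map `φ(-) x`, the trace of `a c` on `V i` is `φ(c x)`.
  obtain ⟨a, ha⟩ := lsmul_surjective (H := H) (V i) (φ.smulRight x)
  have h1 := hc (e i * a)
  rw [mul_assoc, he.trace_mulLeft_mul hd, mul_eq_zero, or_iff_right (hd i), character_apply,
    map_mul, ha, LinearMap.trace_mul_comm] at h1
  rw [← h1, ← LinearMap.trace_smulRight]
  congr 1
  ext y
  simp

end Characters

end IsBlockSystem

end Semisimple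

/-! ### The Grothendieck group and its image in `H*` -/

section Grothendieck

variable {k : Type w} [Field k] {H : Type u} [Ring H] [Algebra k H]

theorem mk_of_exact (L M N : FinModule.{w, u} k H) (f : L.carrier →ₗ[H] M.carrier)
    (g : M.carrier →ₗ[H] N.carrier) (hf : Function.Injective f) (hg : Function.Surjective g)
    (hfg : Function.Exact f g) :
    (QuotientAddGroup.mk (FreeAbelianGroup.of M) : G0.{w, u} k H) =
      QuotientAddGroup.mk (FreeAbelianGroup.of L) + QuotientAddGroup.mk (FreeAbelianGroup.of N) := by
  have h : FreeAbelianGroup.of M - FreeAbelianGroup.of L - FreeAbelianGroup.of N ∈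
      exactRelations.{w, u} k H :=
    AddSubgroup.subset_closure ⟨L, M, N, f, g, hf, hg, hfg, rfl⟩
  rw [← QuotientAddGroup.eq_zero_iff, QuotientAddGroup.mk_sub, QuotientAddGroup.mk_sub, sub_sub,
    sub_eq_zero] at h
  exact h

/-- For `M = 0` the sequence `0 → M → M → M → 0` is exact, so `[M] = 2[M]`. -/
theorem mk_of_subsingleton (M : FinModule.{w, u} k H) [Subsingleton M.carrier] :
    (QuotientAddGroup.mk (FreeAbelianGroup.of M) : G0.{w, u} k H) = 0 := by
  have h := mk_of_exact M M M LinearMap.id LinearMap.id Function.injective_id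
    Function.surjective_id (fun x => ⟨fun _ => ⟨x, rfl⟩, fun _ => Subsingleton.elim _ _⟩)
  simpa using h

theorem mk_of_equiv {L M : FinModule.{w, u} k H} (φ : L.carrier ≃ₗ[H] M.carrier) :
    (QuotientAddGroup.mk (FreeAbelianGroup.of L) : G0.{w, u} k H) =
      QuotientAddGroup.mk (FreeAbelianGroup.of M) := by
  have h := mk_of_exact L M (FinModule.mk PUnit.{u + 1}) φ.toLinearMap 0 φ.injective
    (fun x => ⟨0, Subsingleton.elim _ _⟩)
    (fun x => ⟨fun _ => φ.surjective x, fun _ => Subsingleton.elim _ _⟩)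
  have : Subsingleton (FinModule.mk (k := k) (H := H) PUnit.{u + 1}).carrier :=
    inferInstanceAs (Subsingleton PUnit.{u + 1})
  rw [h, mk_of_subsingleton (FinModule.mk PUnit.{u + 1}), add_zero]

variable {ι : Type*} {V : ι → Type u} [∀ i, AddCommGroup (V i)] [∀ i, Module k (V i)]
  [∀ i, Module H (V i)] [∀ i, IsScalarTower k H (V i)] [∀ i, Module.Finite k (V i)]

/-- The Grothendieck group is generated by the classes of the simple modules. -/
theorem mk_of_mem_closure [IsSemisimpleRing H]
    (hV_all : ∀ (W : Type u) [AddCommGroup W] [Module H W] [IsSimpleModule H W],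
      ∃ i, Nonempty (W ≃ₗ[H] V i)) (n : ℕ) :
    ∀ M : FinModule.{w, u} k H, Module.finrank k M.carrier = n →
    (QuotientAddGroup.mk (FreeAbelianGroup.of M) : G0.{w, u} k H) ∈ AddSubgroup.closure
      (Set.range fun i => (QuotientAddGroup.mk (FreeAbelianGroup.of (FinModule.mk (V i))) :
        G0.{w, u} k H)) := by
  induction n using Nat.strong_induction_on with
  | _ n ih =>
    intro M hM
    rcases subsingleton_or_nontrivial M.carrier with hs | hs
    · rw [mk_of_subsingleton]
      exact zero_mem _
    -- Split off a simple submodule; the quotient has smaller dimension.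
    obtain ⟨N, hN⟩ := IsSemisimpleModule.exists_simple_submodule H M.carrier
    have hNfin : Module.Finite k N :=
      Module.Finite.of_injective (N.subtype.restrictScalars k) N.subtype_injective
    have hQfin : Module.Finite k (M.carrier ⧸ N) :=
      Module.Finite.of_surjective (N.mkQ.restrictScalars k) N.mkQ_surjective
    rw [mk_of_exact (FinModule.mk N) M (FinModule.mk (M.carrier ⧸ N)) N.subtype N.mkQ
      N.subtype_injective N.mkQ_surjective (LinearMap.exact_subtype_mkQ N)]
    refine add_mem ?_ (ih (Module.finrank k (M.carrier ⧸ N)) ?_ _ rfl)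
    · obtain ⟨i, ⟨φ⟩⟩ := hV_all N
      rw [mk_of_equiv (L := FinModule.mk N) (M := FinModule.mk (V i)) φ]
      exact AddSubgroup.subset_closure ⟨i, rfl⟩
    · have h1 := LinearMap.finrank_range_add_finrank_ker (N.mkQ.restrictScalars k)
      rw [LinearMap.range_eq_top (f := N.mkQ.restrictScalars k) |>.mpr N.mkQ_surjective,
        finrank_top] at h1
      have : Nontrivial N := IsSimpleModule.nontrivial H N
      obtain ⟨x, hx⟩ := exists_ne (0 : N)
      have : Nontrivial (LinearMap.ker (N.mkQ.restrictScalars k)) :=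
        ⟨⟨⟨x.1, by simp⟩, 0, fun h => hx (Subtype.ext (Subtype.ext_iff.mp h :))⟩⟩
      have h2 : 0 < Module.finrank k (LinearMap.ker (N.mkQ.restrictScalars k)) :=
        Module.finrank_pos
      omega

theorem span_cls_eq_top [IsSemisimpleRing H]
    (hV_all : ∀ (W : Type u) [AddCommGroup W] [Module H W] [IsSimpleModule H W],
      ∃ i, Nonempty (W ≃ₗ[H] V i)) :
    Submodule.span k (Set.range fun i => cls.{w, u} k H (V i)) = ⊤ := by
  have hmem : ∀ y ∈ AddSubgroup.closure
      (Set.range fun i => (QuotientAddGroup.mk (FreeAbelianGroup.of (FinModule.mk (V i))) :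
        G0.{w, u} k H)), (1 : k) ⊗ₜ[ℤ] y ∈
          Submodule.span k (Set.range fun i => cls.{w, u} k H (V i)) := by
    intro y hy
    induction hy using AddSubgroup.closure_induction with
    | mem y hy =>
      obtain ⟨i, rfl⟩ := hy
      exact Submodule.subset_span ⟨i, rfl⟩
    | zero => simp
    | add x y _ _ hx hy =>
      rw [TensorProduct.tmul_add]
      exact add_mem hx hy
    | neg x _ hx =>
      rw [TensorProduct.tmul_neg]
      exact neg_mem hx
  have htop : ∀ y : G0.{w, u} k H, y ∈ AddSubgroup.closure
      (Set.range fun i => (QuotientAddGroup.mk (FreeAbelianGroup.of (FinModule.mk (V i))) :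
        G0.{w, u} k H)) := by
    intro y
    obtain ⟨y, rfl⟩ := QuotientAddGroup.mk_surjective y
    induction y using FreeAbelianGroup.induction_on with
    | zero => exact zero_mem _
    | of M => exact mk_of_mem_closure hV_all _ M rfl
    | neg M h => exact neg_mem h
    | add x y hx hy => exact add_mem hx hy
  rw [eq_top_iff]
  rintro x -
  induction x using TensorProduct.induction_on with
  | zero => exact zero_mem _
  | add x y hx hy => exact add_mem hx hy
  | tmul a y =>
    rw [← mul_one a, ← smul_eq_mul, ← TensorProduct.smul_tmul']
    exact Submodule.smul_mem _ _ (hmem y (htop y))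

theorem exists_eq_sum_cls [IsSemisimpleRing H] [Fintype ι]
    (hV_all : ∀ (W : Type u) [AddCommGroup W] [Module H W] [IsSimpleModule H W],
      ∃ i, Nonempty (W ≃ₗ[H] V i)) (x : G0k.{w, u} k H) :
    ∃ c : ι → k, ∑ i, c i • cls.{w, u} k H (V i) = x :=
  (Submodule.mem_span_range_iff_exists_fun k).mp
    (by rw [span_cls_eq_top hV_all]; exact Submodule.mem_top)

theorem characterMap_sum_cls [Fintype ι] (c : ι → k) :
    characterMap.{w, u} k H (∑ i, c i • cls.{w, u} k H (V i)) =
      ∑ i, c i • character k H (V i) := by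
  simp only [map_sum, map_smul, characterMap_cls]

/-- Evaluating `∑ⱼ cⱼ χⱼ` at `eᵢ` gives `cᵢ dᵢ`, with `dᵢ ≠ 0` in `k`. -/
theorem IsBlockSystem.characterMap_injective [IsSemisimpleRing H] [Fintype ι] {e : ι → H}
    (he : IsBlockSystem V e) (hd : ∀ i, (Module.finrank k (V i) : k) ≠ 0)
    (hV_all : ∀ (W : Type u) [AddCommGroup W] [Module H W] [IsSimpleModule H W],
      ∃ i, Nonempty (W ≃ₗ[H] V i)) :
    Function.Injective (characterMap.{w, u} k H) := by
  rw [injective_iff_map_eq_zero]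
  intro x hx
  obtain ⟨c, rfl⟩ := exists_eq_sum_cls hV_all x
  rw [characterMap_sum_cls] at hx
  refine Finset.sum_eq_zero fun i _ => ?_
  have h1 := LinearMap.congr_fun hx (e i * 1)
  simp only [LinearMap.sum_apply, LinearMap.smul_apply, smul_eq_mul, LinearMap.zero_apply] at h1
  rw [he.sum_mul_character, character_one, mul_eq_zero, or_iff_left (hd i)] at h1
  rw [h1, zero_smul]

/-- The linear functions defined by elements of `G₀(H) ⊗ k` are the trace functions. -/
theorem IsBlockSystem.mem_range_characterMap_iff [IsAlgClosed k] [IsSemisimpleRing H] [Fintype ι]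
    [∀ i, IsSimpleModule H (V i)] {e : ι → H}
    (he : IsBlockSystem V e) (hd : ∀ i, (Module.finrank k (V i) : k) ≠ 0)
    (hV_all : ∀ (W : Type u) [AddCommGroup W] [Module H W] [IsSimpleModule H W],
      ∃ i, Nonempty (W ≃ₗ[H] V i)) (f : Module.Dual k H) :
    f ∈ LinearMap.range (characterMap.{w, u} k H) ↔ ∀ a b, f (a * b) = f (b * a) := by
  constructor
  · rintro ⟨x, rfl⟩ a b
    obtain ⟨c, rfl⟩ := exists_eq_sum_cls hV_all x
    rw [characterMap_sum_cls]
    simp only [LinearMap.sum_apply, LinearMap.smul_apply, character_mul_comm _ a b]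
  · intro hf
    rw [he.traceFunction_eq hd hf, ← characterMap_sum_cls]
    exact ⟨_, rfl⟩

end Grothendieck

/-! ### Values of the integrals on the blocks -/

section BlockIntegrals

open Coalgebra HopfAlgebra

variable {k : Type w} [Field k] {H : Type u} [Ring H] [HopfAlgebra k H]
  {ι : Type*} {V : ι → Type u} [∀ i, AddCommGroup (V i)] [∀ i, Module k (V i)]
  [∀ i, Module H (V i)] {e : ι → H}

/-- `H` maps onto `End W` but acts by scalars, so `(dim W)² ≤ 1`. -/
theorem finrank_eq_one_of_trivial [IsAlgClosed k] {W : Type*} [AddCommGroup W] [Module k W]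
    [Module H W] [IsScalarTower k H W] [Module.Finite k W] [IsSimpleModule H W]
    (hW : ∀ (h : H) (x : W), h • x = (counit h : k) • x) : Module.finrank k W = 1 := by
  have : Nontrivial W := IsSimpleModule.nontrivial H W
  have h1 : Module.finrank k (Module.End k W) ≤ 1 := by
    refine finrank_le_one (1 : Module.End k W) fun A => ?_
    obtain ⟨h, rfl⟩ := lsmul_surjective (H := H) W A
    exact ⟨counit h, LinearMap.ext fun x => (hW h x).symm⟩
  rw [Module.finrank_linearMap] at h1
  have h2 : 0 < Module.finrank k W := Module.finrank_pos
  nlinarith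

theorem character_of_trivial [IsAlgClosed k] {W : Type*} [AddCommGroup W] [Module k W]
    [Module H W] [IsScalarTower k H W] [Module.Finite k W] [IsSimpleModule H W]
    (hW : ∀ (h : H) (x : W), h • x = (counit h : k) • x) :
    character k H W = (counit : H →ₗ[k] k) := by
  ext h
  have h1 : Algebra.lsmul k k W h = (counit h : k) • (1 : Module.End k W) :=
    LinearMap.ext fun x => hW h x
  rw [character_apply, h1, map_smul, LinearMap.trace_one, finrank_eq_one_of_trivial hW]
  simp

namespace IsBlockSystem

section TrivialBlock

variable {i₀ : ι}

theorem counit_trivial [∀ i, IsSimpleModule H (V i)] (he : IsBlockSystem V e)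
    (hi₀ : ∀ (h : H) (x : V i₀), h • x = (counit h : k) • x) : (counit (e i₀) : k) = 1 := by
  have : Nontrivial (V i₀) := IsSimpleModule.nontrivial H (V i₀)
  obtain ⟨x, hx⟩ := exists_ne (0 : V i₀)
  refine smul_left_injective k hx ?_
  change (counit (e i₀) : k) • x = (1 : k) • x
  rw [← hi₀, he.smul_self, one_smul]

theorem counit_other [∀ i, IsSimpleModule H (V i)] (he : IsBlockSystem V e)
    (hi₀ : ∀ (h : H) (x : V i₀), h • x = (counit h : k) • x) {j : ι} (hj : j ≠ i₀) :
    (counit (e j) : k) = 0 := by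
  have : Nontrivial (V i₀) := IsSimpleModule.nontrivial H (V i₀)
  obtain ⟨x, hx⟩ := exists_ne (0 : V i₀)
  refine smul_left_injective k hx ?_
  change (counit (e j) : k) • x = (0 : k) • x
  rw [← hi₀, he.smul_other j i₀ hj.symm, zero_smul]

variable [∀ i, IsScalarTower k H (V i)]

theorem isLeftIntegral (he : IsBlockSystem V e)
    (hi₀ : ∀ (h : H) (x : V i₀), h • x = (counit h : k) • x) :
    IsLeftIntegral k (e i₀) := by
  intro h
  refine he.ext fun j x => ?_
  rw [mul_smul, smul_assoc]
  by_cases hj : j = i₀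
  · subst hj
    rw [he.smul_self, hi₀]
  · rw [he.smul_other i₀ j hj, smul_zero, smul_zero]

/-- Compute `e i₀ * Λ` twice: `Λ` is a left integral, and so is the central element `e i₀`. -/
theorem leftIntegral_eq [∀ i, IsSimpleModule H (V i)] (he : IsBlockSystem V e)
    (hi₀ : ∀ (h : H) (x : V i₀), h • x = (counit h : k) • x) {Λ : H}
    (hΛ : IsLeftIntegral k Λ) : Λ = (counit Λ : k) • e i₀ := by
  have h1 := hΛ (e i₀)
  rwa [he.counit_trivial hi₀, one_smul, he.mul_comm, he.isLeftIntegral hi₀, eq_comm] at h1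

theorem leftIntegral_mul [∀ i, IsSimpleModule H (V i)] (he : IsBlockSystem V e)
    (hi₀ : ∀ (h : H) (x : V i₀), h • x = (counit h : k) • x) {Λ : H}
    (hΛ : IsLeftIntegral k Λ) (h : H) : Λ * h = (counit h : k) • Λ := by
  rw [he.leftIntegral_eq hi₀ hΛ, smul_mul_assoc, he.mul_comm, he.isLeftIntegral hi₀, smul_comm]

theorem counit_mul_integral [∀ i, IsSimpleModule H (V i)] (he : IsBlockSystem V e)
    (hi₀ : ∀ (h : H) (x : V i₀), h • x = (counit h : k) • x) {Λ : H}
    (hΛ : IsLeftIntegral k Λ) {lam : Module.Dual k H} (hlamΛ : lam Λ = 1) :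
    counit Λ * lam (e i₀) = 1 := by
  rw [← smul_eq_mul, ← map_smul, ← he.leftIntegral_eq hi₀ hΛ, hlamΛ]

end TrivialBlock

variable [∀ i, IsScalarTower k H (V i)] [IsAlgClosed k] [Module.Finite k H]
  [∀ i, Module.Finite k (V i)] [∀ i, IsSimpleModule H (V i)] [Fintype ι]

theorem isUnit_uElt (he : IsBlockSystem V e) (hd : ∀ i, (Module.finrank k (V i) : k) ≠ 0)
    {lam : Module.Dual k H} (hlam : IsRightIntegral lam) {Λ : H} (hΛ : IsLeftIntegral k Λ)
    (hlamΛ : lam Λ = 1) : IsUnit (uElt k Λ) := by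
  have hinj : Function.Injective (LinearMap.mulRight k (uElt k Λ)) := by
    rw [injective_iff_map_eq_zero]
    intro c hc
    -- If `c u = 0`, then `tr(L_{ac}) = lam(a c u) = 0` for all `a`.
    refine he.eq_zero_of_trace_mulLeft hd fun a => ?_
    rw [← integral_mul_uElt hlam hΛ hlamΛ, mul_assoc]
    rw [LinearMap.mulRight_apply] at hc
    rw [hc, mul_zero, map_zero]
  obtain ⟨c, hc⟩ := LinearMap.injective_iff_surjective.mp hinj 1
  have : IsArtinianRing H := IsArtinianRing.of_finite k H
  exact IsUnit.of_mul_eq_one_right c hc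

theorem integral_mul_uElt (he : IsBlockSystem V e)
    (hd : ∀ i, (Module.finrank k (V i) : k) ≠ 0)
    {lam : Module.Dual k H} (hlam : IsRightIntegral lam) {Λ : H} (hΛ : IsLeftIntegral k Λ)
    (hlamΛ : lam Λ = 1) (i : ι) (a : H) :
    lam (e i * a * uElt k Λ) = Module.finrank k (V i) * character k H (V i) a := by
  rw [HopfStar.integral_mul_uElt hlam hΛ hlamΛ, he.trace_mulLeft_mul hd]

/-- The central element `S(u) u` acts on `V i` by a scalar `c`, so `χᵢ(S(u)) = c χᵢ(u⁻¹)`. Since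
`lam(eᵢ) = dᵢ χᵢ(u⁻¹)`, its vanishing would force `χᵢ(S(u)) = 0`. But `χᵢ ∘ S` is a trace function,
with value `ε(Λ) dᵢ ≠ 0` at `u`. -/
theorem integral_idempotent_ne_zero (he : IsBlockSystem V e)
    (hd : ∀ i, (Module.finrank k (V i) : k) ≠ 0)
    {lam : Module.Dual k H} (hlam : IsRightIntegral lam) {Λ : H} (hΛ : IsLeftIntegral k Λ)
    (hΛ' : ∀ h : H, Λ * h = (counit h : k) • Λ) (hεΛ : (counit Λ : k) ≠ 0)
    (hlamΛ : lam Λ = 1) (i : ι) : lam (e i) ≠ 0 := by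
  intro h0
  obtain ⟨U, hU⟩ := he.isUnit_uElt hd hlam hΛ hlamΛ
  -- Applying `S` to `u h = S²(h) u` gives `S(h) S(u) = S(u) S³(h)`, while `S³(h) u = u S(h)`. So
  -- `S(u) u` commutes with `S(h)`, and `S` is onto.
  have hcomm : ∀ h : H, h * (antipode k (U : H) * U) = antipode k (U : H) * U * h := by
    intro h
    obtain ⟨h, rfl⟩ := antipode_surjective hlam hΛ hlamΛ h
    have h1 := congrArg (antipode k) (uElt_mul hΛ' h)
    rw [antipode_mul_antidistrib, antipode_mul_antidistrib, ← hU] at h1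
    have h2 := uElt_mul hΛ' (antipode k h)
    rw [← hU] at h2
    rw [← mul_assoc, h1, mul_assoc, ← h2, mul_assoc]
  let T : Module.End H (V i) :=
    { toFun := fun x => (antipode k (U : H) * U) • x
      map_add' := smul_add _
      map_smul' := fun h x => by rw [RingHom.id_apply, smul_smul, smul_smul, hcomm] }
  obtain ⟨c, hc⟩ := (IsSimpleModule.algebraMap_end_bijective_of_isAlgClosed
    (A := H) (V := V i) k).2 T
  have hz : ∀ x : V i, (antipode k (U : H) * U) • x = c • x := fun x =>
    (LinearMap.congr_fun hc x).symm
  have hchar : character k H (V i) (antipode k (U : H)) =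
      c * character k H (V i) (U⁻¹ : Hˣ) := by
    rw [character_apply, character_apply, ← smul_eq_mul, ← map_smul]
    congr 1
    ext x
    simp only [Algebra.lsmul_coe, LinearMap.smul_apply]
    rw [← hz, smul_smul, mul_assoc, Units.mul_inv, mul_one]
  have hinv := he.integral_mul_uElt hd hlam hΛ hlamΛ i (U⁻¹ : Hˣ)
  rw [← hU, mul_assoc, Units.inv_mul, mul_one, h0, eq_comm, mul_eq_zero,
    or_iff_right (hd i)] at hinv
  have htr := traceFunction_uElt (f := character k H (V i) ∘ₗ antipode k) (fun a b => by
    simp only [LinearMap.comp_apply, antipode_mul_antidistrib]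
    exact character_mul_comm _ _ _) Λ
  rw [← hU, LinearMap.comp_apply, LinearMap.comp_apply, hchar, hinv, mul_zero, antipode_one,
    character_one, eq_comm] at htr
  exact mul_ne_zero hεΛ (hd i) htr

theorem counit_mul_integral_of_antipode_antipode (he : IsBlockSystem V e)
    (hd : ∀ i, (Module.finrank k (V i) : k) ≠ 0)
    {lam : Module.Dual k H} (hlam : IsRightIntegral lam) {Λ : H} (hΛ : IsLeftIntegral k Λ)
    (hlamΛ : lam Λ = 1) (hS : ∀ h : H, antipode k (antipode k h) = h) (i : ι) :
    counit Λ * lam (e i) = (Module.finrank k (V i) : k) ^ 2 := by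
  have h := he.integral_mul_uElt hd hlam hΛ hlamΛ i 1
  rwa [uElt_of_antipode_antipode hS, mul_one, mul_smul_comm, mul_one, map_smul, smul_eq_mul,
    character_one, ← sq] at h

end IsBlockSystem

end BlockIntegrals

/-! ### The element `v` -/

section VElement

open Coalgebra HopfAlgebra

variable {k : Type w} [Field k] {H : Type u} [Ring H] [HopfAlgebra k H]
  {ι : Type*} [Fintype ι] {V : ι → Type u} [∀ i, AddCommGroup (V i)]
  [∀ i, Module H (V i)] {e : ι → H}

theorem IsBlockSystem.vElt_mul (he : IsBlockSystem V e) {Λ : H}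
    (hΛ : ∀ h : H, Λ * h = (counit h : k) • Λ) (d : ι → ℕ) (s : k) (r : ι → k) (h : H) :
    vElt Λ e d s r * h = antipode k (antipode k h) * vElt Λ e d s r := by
  have hcomm : (∑ i, (r i / (d i : k)) • e i) * h = h * ∑ i, (r i / (d i : k)) • e i := by
    rw [Finset.sum_mul, Finset.mul_sum]
    refine Finset.sum_congr rfl fun i _ => ?_
    rw [smul_mul_assoc, mul_smul_comm, he.mul_comm]
  rw [vElt, mul_assoc, hcomm, ← mul_assoc, ← mul_assoc, smul_mul_assoc, uElt_mul hΛ,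
    mul_smul_comm]

variable [∀ i, Module k (V i)]

theorem IsBlockSystem.counit_vElt [∀ i, IsSimpleModule H (V i)] (he : IsBlockSystem V e) {i₀ : ι}
    (hi₀ : ∀ (h : H) (x : V i₀), h • x = (counit h : k) • x) {Λ : H} {d : ι → ℕ}
    (hd : d i₀ = 1) {s : k} (hs : s ≠ 0) (hsΛ : s ^ 2 = counit Λ) (r : ι → k) :
    (counit (vElt Λ e d s r) : k) = s * r i₀ := by
  rw [vElt, Bialgebra.counit_mul, map_smul, counit_uElt, ← hsΛ, map_sum,
    Finset.sum_eq_single i₀, map_smul, he.counit_trivial hi₀, hd]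
  · simp only [smul_eq_mul, Nat.cast_one, div_one, mul_one]
    field_simp
  · intro j _ hj
    rw [map_smul, he.counit_other hi₀ hj, smul_zero]
  · simp

variable [∀ i, IsScalarTower k H (V i)]

theorem IsBlockSystem.isUnit_sum_smul (he : IsBlockSystem V e) {c : ι → k} (hc : ∀ i, c i ≠ 0) :
    IsUnit (∑ i, c i • e i) := by
  have key : ∀ a b : ι → k, (∀ i, a i * b i = 1) → (∑ i, a i • e i) * (∑ i, b i • e i) = 1 := by
    intro a b hab
    refine he.ext fun i x => ?_
    rw [mul_smul, he.sum_smul_smul, he.sum_smul_smul, smul_smul, hab, one_smul, one_smul]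
  exact ⟨⟨_, ∑ i, (c i)⁻¹ • e i, key _ _ fun i => mul_inv_cancel₀ (hc i),
    key _ _ fun i => inv_mul_cancel₀ (hc i)⟩, rfl⟩

theorem IsBlockSystem.isUnit_vElt (he : IsBlockSystem V e) {Λ : H} (hu : IsUnit (uElt k Λ))
    {d : ι → ℕ} {s : k} {r : ι → k} (hs : s ≠ 0) (hr : ∀ i, r i ≠ 0)
    (hd : ∀ i, (d i : k) ≠ 0) : IsUnit (vElt Λ e d s r) :=
  (hu.smul (Units.mk0 s⁻¹ (inv_ne_zero hs))).mul
    (he.isUnit_sum_smul fun i => div_ne_zero (hr i) (hd i))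

/-- On `V i` the element acts as `s⁻¹ s² rᵢ / dᵢ = s rᵢ / dᵢ = 1`. -/
theorem IsBlockSystem.vElt_eq_one (he : IsBlockSystem V e) {Λ : H}
    (hS : ∀ h : H, antipode k (antipode k h) = h) {d : ι → ℕ} (hd : ∀ i, (d i : k) ≠ 0)
    {s : k} (hs : s ≠ 0) (hsΛ : s ^ 2 = counit Λ) {r : ι → k} (hr : ∀ i, s * r i = d i) :
    vElt Λ e d s r = 1 := by
  refine he.ext fun i x => ?_
  rw [vElt, mul_smul, he.sum_smul_smul, uElt_of_antipode_antipode hS, ← hsΛ, smul_smul,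
    smul_assoc, one_smul, one_smul, smul_smul, ← hr i]
  have hri : r i ≠ 0 := fun h => hd i (by rw [← hr, h, mul_zero])
  rw [show s⁻¹ * s ^ 2 * (r i / (s * r i)) = 1 by field_simp, one_smul]

end VElement

/-- A square root whose product with `s` is `d`, given that the squares agree. -/
theorem exists_root {k : Type*} [Field k] {s a d : k} (hs : s ≠ 0)
    (h : s ^ 2 * a = d ^ 2) : ∃ r, r ^ 2 = a ∧ s * r = d :=
  ⟨d / s, by rw [div_pow, ← h]; field_simp, by field_simp⟩

end HopfStar

end

theorem mainTheorem8 {k : Type w} [Field k] [IsAlgClosed k] {H : Type u} [Ring H]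
    [HopfAlgebra k H] [Module.Finite k H] [IsSemisimpleRing H]
    (p : ℕ) [CharP k p] (hp : 0 < p)
    (hp_sq : Module.finrank k H < p ^ 2) (hp_dvd : ¬ p ∣ 2 * Module.finrank k H)
    -- a complete list of pairwise non-isomorphic simple modules, with the trivial one at `i₀`
    {ι : Type*} [Fintype ι] (V : ι → Type u) [∀ i, AddCommGroup (V i)] [∀ i, Module k (V i)]
    [∀ i, Module H (V i)] [∀ i, IsScalarTower k H (V i)] [∀ i, Module.Finite k (V i)]
    [∀ i, IsSimpleModule H (V i)]
    (hV_inj : ∀ i j, Nonempty (V i ≃ₗ[H] V j) → i = j)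
    (hV_all : ∀ (W : Type u) [AddCommGroup W] [Module H W] [IsSimpleModule H W],
      ∃ i, Nonempty (W ≃ₗ[H] V i))
    (i₀ : ι) (hi₀ : ∀ (h : H) (x : V i₀), h • x = (Coalgebra.counit h : k) • x)
    -- the central primitive idempotents
    (e : ι → H) (he_self : ∀ i (x : V i), e i • x = x)
    (he_other : ∀ i j, j ≠ i → ∀ x : V j, e i • x = 0)
    -- the integrals
    (Λ : H) (lam : Module.Dual k H) (hΛ : HopfStar.IsLeftIntegral k Λ)
    (hlam : HopfStar.IsRightIntegral lam) (hlamΛ : lam Λ = 1) :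
    -- elements of `G₀(H) ⊗ k` are determined by the functions on `H` they define
    Function.Injective (HopfStar.characterMap.{w, u} k H) ∧
    -- the class of the trivial module is the function `ε`
    HopfStar.characterMap.{w, u} k H (HopfStar.cls.{w, u} k H (V i₀)) =
      (Coalgebra.counit : H →ₗ[k] k) ∧
    -- the square roots can be chosen with the normalizations used below
    (∃ (s : k) (r : ι → k), s ^ 2 = Coalgebra.counit Λ ∧ (∀ i, r i ^ 2 = lam (e i)) ∧
      s * r i₀ = 1 ∧
      ((∀ h : H, HopfAlgebra.antipode k (HopfAlgebra.antipode k h) = h) →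
        ∀ i, s * r i = (Module.finrank k (V i) : k))) ∧
    ∀ (s : k) (r : ι → k), s ^ 2 = Coalgebra.counit Λ → (∀ i, r i ^ 2 = lam (e i)) →
      IsUnit (HopfStar.vElt Λ e (fun i => Module.finrank k (V i)) s r) ∧
      ∃ mul : HopfStar.G0k.{w, u} k H →ₗ[k] HopfStar.G0k.{w, u} k H →ₗ[k]
          HopfStar.G0k.{w, u} k H,
        (∀ x y, HopfStar.characterMap.{w, u} k H (mul x y) =
          HopfStar.star (HopfStar.vElt Λ e (fun i => Module.finrank k (V i)) s r)
            (HopfStar.characterMap.{w, u} k H x) (HopfStar.characterMap.{w, u} k H y)) ∧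
        (∀ x y z, mul (mul x y) z = mul x (mul y z)) ∧
        (s * r i₀ = 1 → ∀ x, mul (HopfStar.cls.{w, u} k H (V i₀)) x = x ∧
          mul x (HopfStar.cls.{w, u} k H (V i₀)) = x) ∧
        ((∀ h : H, HopfAlgebra.antipode k (HopfAlgebra.antipode k h) = h) →
          (∀ i, s * r i = (Module.finrank k (V i) : k)) →
          ∀ x y, HopfStar.characterMap.{w, u} k H (mul x y) =
            HopfStar.conv (HopfStar.characterMap.{w, u} k H x)
              (HopfStar.characterMap.{w, u} k H y)) := by
  classical
  have he : HopfStar.IsBlockSystem V e :=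
    ⟨fun h hh => HopfStar.eq_zero_of_smul_eq_zero hV_all hh, he_self, he_other⟩
  have hd : ∀ i, (Module.finrank k (V i) : k) ≠ 0 := fun i =>
    HopfStar.finrank_cast_ne_zero (H := H) (V i) p hp_sq
  have hd₀ : Module.finrank k (V i₀) = 1 := HopfStar.finrank_eq_one_of_trivial hi₀
  have hΛ' := he.leftIntegral_mul hi₀ hΛ
  have hΛ₀ := he.counit_mul_integral hi₀ hΛ hlamΛ
  have hεΛ : (Coalgebra.counit Λ : k) ≠ 0 := left_ne_zero_of_mul_eq_one hΛ₀
  have hu := he.isUnit_uElt hd hlam hΛ hlamΛ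
  have hlam_ne := he.integral_idempotent_ne_zero hd hlam hΛ hΛ' hεΛ hlamΛ
  have hinj := he.characterMap_injective hd hV_all
  have htriv : HopfStar.characterMap.{w, u} k H (HopfStar.cls.{w, u} k H (V i₀)) =
      (Coalgebra.counit : H →ₗ[k] k) := by
    rw [HopfStar.characterMap_cls, HopfStar.character_of_trivial hi₀]
  refine ⟨hinj, htriv, ?_, ?_⟩
  · obtain ⟨s, hs⟩ := IsAlgClosed.exists_pow_nat_eq (Coalgebra.counit Λ : k) two_pos
    have hs0 : s ≠ 0 := fun h => hεΛ (by rw [← hs, h, zero_pow two_ne_zero])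
    have hroot : ∀ i, ∃ r : k, r ^ 2 = lam (e i) ∧ (i = i₀ → s * r = 1) ∧
        ((∀ h : H, HopfAlgebra.antipode k (HopfAlgebra.antipode k h) = h) →
          s * r = (Module.finrank k (V i) : k)) := by
      intro i
      by_cases hS : ∀ h : H, HopfAlgebra.antipode k (HopfAlgebra.antipode k h) = h
      -- If `S² = id`, take `rᵢ = dᵢ / s`; this is consistent at `i₀` because `d₀ = 1`. Otherwise
      -- only the root at `i₀` is normalized.
      · obtain ⟨r, hr, hsr⟩ := HopfStar.exists_root hs0 (hs.symm ▸
          he.counit_mul_integral_of_antipode_antipode hd hlam hΛ hlamΛ hS i)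
        refine ⟨r, hr, ?_, fun _ => hsr⟩
        rintro rfl
        rw [hsr, hd₀, Nat.cast_one]
      · by_cases hi : i = i₀
        · subst hi
          obtain ⟨r, hr, hsr⟩ := HopfStar.exists_root (a := lam (e i)) (d := 1) hs0
            (by rw [hs, hΛ₀, one_pow])
          exact ⟨r, hr, fun _ => hsr, fun h => absurd h hS⟩
        · obtain ⟨r, hr⟩ := IsAlgClosed.exists_pow_nat_eq (lam (e i)) two_pos
          exact ⟨r, hr, fun h => absurd h hi, fun h => absurd h hS⟩
    choose r hr hr₀ hrS using hroot
    exact ⟨s, r, hs, hr, hr₀ i₀ rfl, fun hS i => hrS i hS⟩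
  · intro s r hs hr
    have hs0 : s ≠ 0 := fun h => hεΛ (by rw [← hs, h, zero_pow two_ne_zero])
    have hr0 : ∀ i, r i ≠ 0 := fun i h => hlam_ne i (by rw [← hr, h, zero_pow two_ne_zero])
    have hv := he.isUnit_vElt (d := fun i => Module.finrank k (V i)) hu hs0 hr0 hd
    have hvS := he.vElt_mul hΛ' (fun i => Module.finrank k (V i)) s r
    have hεv := he.counit_vElt hi₀ (d := fun i => Module.finrank k (V i)) hd₀ hs0 hs r
    have hv1 : (∀ h : H, HopfAlgebra.antipode k (HopfAlgebra.antipode k h) = h) →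
        (∀ i, s * r i = (Module.finrank k (V i) : k)) →
        HopfStar.vElt Λ e (fun i => Module.finrank k (V i)) s r = 1 := fun hS hsr =>
      he.vElt_eq_one hS hd hs0 hs hsr
    generalize HopfStar.vElt Λ e (fun i => Module.finrank k (V i)) s r = v at hv hvS hεv hv1 ⊢
    have hrange := he.mem_range_characterMap_iff hd hV_all
    have hstar : ∀ x y : HopfStar.G0k.{w, u} k H, HopfStar.star v
        (HopfStar.characterMap.{w, u} k H x) (HopfStar.characterMap.{w, u} k H y) ∈
        LinearMap.range (HopfStar.characterMap.{w, u} k H) := fun x y =>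
      (hrange _).mpr (HopfStar.star_mul_comm hv hvS ((hrange _).mp ⟨x, rfl⟩)
        ((hrange _).mp ⟨y, rfl⟩))
    -- The product is a chosen preimage of `⋆`; injectivity of `characterMap` gives it bilinearity,
    -- and below associativity and the unit laws.
    choose m hm using hstar
    let B := (HopfStar.starBilin v).compl₁₂ (HopfStar.characterMap.{w, u} k H)
      (HopfStar.characterMap.{w, u} k H)
    have hmB : ∀ x y, HopfStar.characterMap.{w, u} k H (m x y) = B x y := hm
    let mul : HopfStar.G0k.{w, u} k H →ₗ[k] HopfStar.G0k.{w, u} k H →ₗ[k]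
        HopfStar.G0k.{w, u} k H := LinearMap.mk₂ k m
      (fun x y z => hinj (by rw [map_add]; simp only [hmB, map_add, LinearMap.add_apply]))
      (fun c x y => hinj (by rw [map_smul]; simp only [hmB, map_smul, LinearMap.smul_apply]))
      (fun x y z => hinj (by rw [map_add]; simp only [hmB, map_add]))
      (fun c x y => hinj (by rw [map_smul]; simp only [hmB, map_smul]))
    have hmul : ∀ x y, HopfStar.characterMap.{w, u} k H (mul x y) = HopfStar.star v
        (HopfStar.characterMap.{w, u} k H x) (HopfStar.characterMap.{w, u} k H y) := hm
    refine ⟨hv, mul, hmul, fun x y z => hinj ?_, fun hsr x => ⟨hinj ?_, hinj ?_⟩,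
      fun hS hsr x y => ?_⟩
    · simp only [hmul, HopfStar.star_assoc hv]
    · rw [hmul, htriv, HopfStar.counit_star hv, hεv, hsr, one_smul]
    · rw [hmul, htriv, HopfStar.star_counit hv, hεv, hsr, one_smul]
    · rw [hmul, hv1 hS hsr, HopfStar.star_one]
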